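/- Fix integers $1\le M\le d$. For a student width $m$ and a weight matrix $W=(w_1,\dots,w_m)\in(\mathbb R^d)^m$ let $$L(W)=\mathbb E_{x\sim\mathrm{Unif}(\mathbb S^{d-1})}\Big[\Big(\sum_{i=1}^m\sigma(w_i\cdot x)-\sum_{j=1}^M\sigma(e_j\cdot x)\Big)^2\Big],\qquad \sigma(z)=\max(0,z),$$ where $e_1,\dots,e_d$ is the canonical basis of $\mathbb R^d$. For $j\le M$ put $S_j=\{a e_j: a>0\}$; a neuron (row) $w_i\in S_j$ is said to be of type $j$, and its non-zero element is then $w_{i,j}$. For $m\ge M$, call a random weight matrix $W$ of width $m$ a uniformly distributed solution if almost surely $L(W)=0$ and every row of $W$ belongs to $S_1\cup\dots\cup S_M$; the type vector $\alpha=(\alpha_1,\dots,\alpha_M)$, defined by the condition that exactly $\alpha_j+1$ rows are of type $j$, has the multinomial distribution $\mathrm{Multi}(m-M;\frac1M,\dots,\frac1M)$; and, given the type vector, for each $j$ the vector of the non-zero elements of the rows of type $j$ (in the order of the rows) is uniformly distributed on the simplex $\{u\in\mathbb R^{\alpha_j+1}: u_k\ge0,\ \sum_k u_k=1\}$. For two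 weight matrices $W^{(1)},W^{(2)}$ of width $m$ let $\widetilde W^{(2)}$ be the following row permutation of $W^{(2)}$. For each $j\le M$, list the rows of type $j$ of $W^{(1)}$, and those of $W^{(2)}$, in descending order of their non-zero elements (ties in the order of the rows), and put the $r$-th row of the second list in the position of the $r$-th row of the first list, for all $r$ up to the smaller of the two lengths. Then put the remaining rows of $W^{(2)}$, one after the other, into the remaining positions. Define the barrier $$B_m=\sup_{\lambda\in[0,1]}\Big\{L\big(\lambda W^{(1)}+(1-\lambda)\widetilde W^{(2)}\big)-\lambda L(W^{(1)})-(1-\lambda)L(\widetilde W^{(2)})\Big\}.$$ **Theorem.** There is a constant $C$, depending only on $M$ and $d$, such that the following holds. For every $m\ge M$ let $W^{(1)}=W^{(1)}_m$ and $W^{(2)}=W^{(2)}_m$ be uniformly distributed solutions of width $m$, all defined on one probability space and with an arbitrary joint distribution, and let $B_m$ be the barrier of this pair. Then 1. for every $m\ge M$, $B_m$ is integrable and $\mathbb E[B_m]\le C\,m^{-1/2}$, and $\mathbb E[B_m]\to0$ as $m\to\infty$; 2. almost surely, $B_m\to0$ as $m\to\infty$ and $|B_m|\le C\,m^{-1/2}$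 for all sufficiently large $m$. -/

import Mathlib

open MeasureTheory ProbabilityTheory Filter Topology

namespace LMC

noncomputable section

/-- The uniform probability distribution on the unit sphere of `ℝ^d` (for `1 ≤ d`): normalized
surface measure. -/
def sphereUniform (d : ℕ) :
    Measure (Metric.sphere (0 : EuclideanSpace ℝ (Fin d)) 1) :=
  ProbabilityTheory.cond (volume : Measure (EuclideanSpace ℝ (Fin d))).toSphere Set.univ

/-- The ReLU activation. -/
def relu (z : ℝ) : ℝ := max 0 z

/-- The weights of a student network of width `m` on `ℝ^d`; row `i` is the `i`-th neuron. -/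
abbrev Weights (m d : ℕ) : Type := Fin m → EuclideanSpace ℝ (Fin d)

/-- The teacher neuron `e_j`, for `j = 1, …, M ≤ d`. -/
def teacher {M d : ℕ} (h : M ≤ d) (j : Fin M) : EuclideanSpace ℝ (Fin d) :=
  EuclideanSpace.single (Fin.castLE h j) 1

/-- The population square loss of the student network with weights `W` against the teacher
network `x ↦ ∑ j, relu ⟪e_j, x⟫`, for inputs uniform on the unit sphere. -/
def loss {M d : ℕ} (h : M ≤ d) {m : ℕ} (W : Weights m d) : ℝ :=
  ∫ x : Metric.sphere (0 : EuclideanSpace ℝ (Fin d)) 1,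
    ((∑ i, relu (inner ℝ (W i) (x : EuclideanSpace ℝ (Fin d)))) -
      ∑ j, relu (inner ℝ (teacher h j) (x : EuclideanSpace ℝ (Fin d)))) ^ 2
    ∂(sphereUniform d)

/-- The excess of the loss over its linear interpolation, at the point `s W₁ + (1 - s) W₂`. -/
def excess {M d : ℕ} (h : M ≤ d) {m : ℕ} (W₁ W₂ : Weights m d) (s : ℝ) : ℝ :=
  loss h (s • W₁ + (1 - s) • W₂) - (s * loss h W₁ + (1 - s) * loss h W₂)

/-- The linear barrier between two weight matrices. -/
def barrier {M d : ℕ} (h : M ≤ d) {m : ℕ} (W₁ W₂ : Weights m d) : ℝ :=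
  ⨆ s : Set.Icc (0 : ℝ) 1, excess h W₁ W₂ s

theorem loss_le {M d : ℕ} (h : M ≤ d) {m : ℕ} (W : Weights m d) {K : ℝ}
    (hK : ∑ i, ‖W i‖ ≤ K) :
    |loss h W| ≤ (K + M) ^ 2 * (sphereUniform d).real Set.univ := by
  have hr : ∀ z : ℝ, |relu z| ≤ |z| := fun z => by
    unfold relu
    rcases le_total z 0 with hz | hz
    · simp [max_eq_left hz]
    · simp [max_eq_right hz]
  have hin : ∀ (w : EuclideanSpace ℝ (Fin d))
      (x : Metric.sphere (0 : EuclideanSpace ℝ (Fin d)) 1),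
      |relu (inner ℝ w (x : EuclideanSpace ℝ (Fin d)))| ≤ ‖w‖ := fun w x => by
    refine (hr _).trans ((abs_real_inner_le_norm _ _).trans ?_)
    simp
  have : IsFiniteMeasure (sphereUniform d) := by
    unfold sphereUniform
    infer_instance
  unfold loss
  rw [← Real.norm_eq_abs]
  refine norm_integral_le_of_norm_le_const (μ := sphereUniform d) (Eventually.of_forall fun x => ?_)
  rw [norm_pow, Real.norm_eq_abs]
  refine pow_le_pow_left₀ (abs_nonneg _) ((abs_sub _ _).trans (add_le_add ?_ ?_)) 2
  · exact (Finset.abs_sum_le_sum_abs _ _).trans ((Finset.sum_le_sum fun i _ => hin _ x).trans hK)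
  · refine (Finset.abs_sum_le_sum_abs _ _).trans
      ((Finset.sum_le_sum fun j _ => hin (teacher h j) x).trans ?_)
    simp [teacher]

/-- The set whose supremum is the barrier is bounded. -/
theorem bddAbove_excess {M d : ℕ} (h : M ≤ d) {m : ℕ} (W₁ W₂ : Weights m d) :
    BddAbove (Set.range fun s : Set.Icc (0 : ℝ) 1 => excess h W₁ W₂ s) := by
  refine ⟨((∑ i, ‖W₁ i‖ + ∑ i, ‖W₂ i‖) + M) ^ 2 * (sphereUniform d).real Set.univ, ?_⟩
  rintro _ ⟨⟨s, h0, h1⟩, rfl⟩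
  have hpos : ∀ W : Weights m d, 0 ≤ loss h W := fun W => integral_nonneg fun x => sq_nonneg _
  have hb : ∑ i, ‖(s • W₁ + (1 - s) • W₂) i‖ ≤ ∑ i, ‖W₁ i‖ + ∑ i, ‖W₂ i‖ := by
    rw [← Finset.sum_add_distrib]
    refine Finset.sum_le_sum fun i _ => (norm_add_le _ _).trans ?_
    simp only [Pi.smul_apply, norm_smul, Real.norm_eq_abs, abs_of_nonneg h0,
      abs_of_nonneg (sub_nonneg.2 h1)]
    nlinarith [norm_nonneg (W₁ i), norm_nonneg (W₂ i)]
  have := (abs_le.1 (loss_le h _ hb)).2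
  have := mul_nonneg h0 (hpos W₁)
  have := mul_nonneg (sub_nonneg.2 h1) (hpos W₂)
  simp only [excess]
  linarith

/-- The global minima manifold: the zero set of the loss. -/
def globalMinima {M d : ℕ} (h : M ≤ d) (m : ℕ) : Set (Weights m d) := {W | loss h W = 0}

/-- The open ray `S_j = {a e_j : a > 0}`; a neuron in `S_j` is of type `j`. -/
def ray {M d : ℕ} (h : M ≤ d) (j : Fin M) : Set (EuclideanSpace ℝ (Fin d)) :=
  {w | ∃ a : ℝ, 0 < a ∧ w = a • teacher h j}

open Classical in
/-- The row indices of the neurons of type `j`, in increasing order. -/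
def typeRows {M d : ℕ} (h : M ≤ d) {m : ℕ} (W : Weights m d) (j : Fin M) : List (Fin m) :=
  (List.finRange m).filter fun i => decide (W i ∈ ray h j)

/-- The vector of the non-zero elements of the neurons of type `j`, in the order of their rows,
for a weight matrix with exactly `n` neurons of type `j`. -/
def typeEntries {M d : ℕ} (h : M ≤ d) {m : ℕ} (W : Weights m d) (j : Fin M) (n : ℕ) :
    EuclideanSpace ℝ (Fin n) :=
  WithLp.toLp 2 fun k =>
    ((typeRows h W j).map fun i => W i (Fin.castLE h j)).getD (k : ℕ) 0

/-- The row indices of the neurons of type `j`, sorted by their non-zero element in descending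
order (ties keep the order of the rows). -/
def sortedRows {M d : ℕ} (h : M ≤ d) {m : ℕ} (W : Weights m d) (j : Fin M) : List (Fin m) :=
  (typeRows h W j).mergeSort
    fun a b => decide (W b (Fin.castLE h j) ≤ W a (Fin.castLE h j))

/-- The assignments made by the matching loop, as pairs (row of `W₁`, row of `W₂`): for each type,
the largest neurons of that type in `W₂` are assigned, in descending order, to the rows of the
neurons of that type in `W₁`, in descending order, as long as there are such rows. -/
def matchedPairs {M d : ℕ} (h : M ≤ d) {m : ℕ} (W₁ W₂ : Weights m d) : List (Fin m × Fin m) :=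
  (List.finRange M).flatMap fun j => (sortedRows h W₁ j).zip (sortedRows h W₂ j)

/-- All assignments: the matched ones, and then the unassigned rows of `W₂` put one after the other
into the empty rows. -/
def allPairs {M d : ℕ} (h : M ≤ d) {m : ℕ} (W₁ W₂ : Weights m d) : List (Fin m × Fin m) :=
  matchedPairs h W₁ W₂ ++
    ((List.finRange m).filter fun i => decide (i ∉ (matchedPairs h W₁ W₂).map Prod.fst)).zip
      ((List.finRange m).filter fun i => decide (i ∉ (matchedPairs h W₁ W₂).map Prod.snd))

/-- The rows of `W₂` permuted by the matching algorithm so as to fit `W₁`. (Every row `i` occurs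
exactly once as a first component of `allPairs`, so the default value of `getD` is not used.) -/
def permuted {M d : ℕ} (h : M ≤ d) {m : ℕ} (W₁ W₂ : Weights m d) : Weights m d :=
  fun i => W₂ (((allPairs h W₁ W₂).lookup i).getD i)

/-- The uniform probability distribution on the standard simplex with `a + 1` vertices:
normalized `a`-dimensional Hausdorff measure. -/
def simplexUniform (a : ℕ) : Measure (EuclideanSpace ℝ (Fin (a + 1))) :=
  ProbabilityTheory.cond (Measure.hausdorffMeasure (a : ℝ))
    {x | (∀ k, 0 ≤ x k) ∧ ∑ k, x k = 1}

/-- The event that the random weight matrix `W` has type vector `α`, that is, exactly `α j + 1`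
neurons of type `j`, for each `j`. -/
def typeEvent {M d : ℕ} (h : M ≤ d) {m : ℕ} {Ω : Type*} (W : Ω → Weights m d) (α : Fin M → ℕ) :
    Set Ω :=
  {ω | ∀ j, (typeRows h (W ω) j).length = α j + 1}

/-- A uniformly distributed solution: a random global minimum without zero neurons whose type
vector has the multinomial distribution `Multi(m - M; 1/M, …, 1/M)` and for which, given the type
vector, the non-zero elements of the neurons of each type are uniform on the simplex. Nothing is
asked about the order of the types among the rows, nor about the dependence between the types. -/
structure IsUniformSolution {M d : ℕ} (h : M ≤ d) {m : ℕ} {Ω : Type*} [MeasurableSpace Ω]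
    (P : Measure Ω) (W : Ω → Weights m d) : Prop where
  aemeasurable : AEMeasurable W P
  global_min : ∀ᵐ ω ∂P, W ω ∈ globalMinima h m
  no_zero : ∀ᵐ ω ∂P, ∀ i, ∃ j, W ω i ∈ ray h j
  multinomial : ∀ α : Fin M → ℕ, (∑ j, α j) + M = m →
    P (typeEvent h W α) =
      ENNReal.ofReal ((Nat.multinomial Finset.univ α : ℝ) * (1 / (M : ℝ)) ^ (m - M))
  simplex : ∀ α : Fin M → ℕ, (∑ j, α j) + M = m → ∀ j,
    HasLaw (fun ω => typeEntries h (W ω) j (α j + 1)) (simplexUniform (α j))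
      (ProbabilityTheory.cond P (typeEvent h W α))

end

end LMC

namespace LMC

open scoped ENNReal

/-! ### Lists -/

/-! Almost surely both matrices split the teacher: every row lies on a ray and the entries of each
type sum to one (`IsSplitTeacher`). Since ReLU is positively homogeneous, two rows on the same ray
interpolate linearly at the level of outputs. Matched pairs therefore cause no error along the
segment, and only the unmatched rows matter.

If one matrix has `N` rows of a type and the other `n < N`, the unmatched ones carry the `N - n`
smallest entries, whose total is at most their share `(N - n) / N` of one
(`sum_drop_mul_length_le`). With `N` and `n` compared to `m / M`, the output error is, uniformly on
the sphere, a constant times `1 / m` times the total deviation of the type counts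
(`abs_interpolation_sub_teacher_le`). Squaring gives a barrier of at most a constant times `1 / m`
times the sum of the squared deviations in units of `√m`
(`IsSplitTeacher.barrier_le_scaledDeviation`).

The rest is multinomial concentration. The generating function at `t = ±1 / √m` bounds all moments
of the scaled deviations uniformly in `m` (`lintegral_abs_typeCount_pow_le`). Second moments give an
expected barrier of order `1 / m`, stronger than claimed; sixth moments and Borel–Cantelli give the
almost sure rate. The pointwise bound is a sum of terms in one matrix each, so the coupling never
enters. -/

theorem map_fst_zip_eq_take {α β : Type*} (l : List α) (l' : List β) :
    (l.zip l').map Prod.fst = l.take l'.length := by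
  induction l generalizing l' with
  | nil => simp
  | cons a l ih => cases l' <;> simp [ih]

theorem map_snd_zip_eq_take {α β : Type*} (l : List α) (l' : List β) :
    (l.zip l').map Prod.snd = l'.take l.length := by
  induction l generalizing l' with
  | nil => simp
  | cons a l ih => cases l' <;> simp [ih]

theorem lookup_eq_some_of_mem {α β : Type*} [BEq α] [LawfulBEq α] {l : List (α × β)}
    (hl : (l.map Prod.fst).Nodup) {a : α} {b : β} (h : (a, b) ∈ l) : l.lookup a = some b := by
  induction l with
  | nil => simp at h
  | cons c l ih =>
    obtain ⟨c₁, c₂⟩ := c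
    simp only [List.map_cons, List.nodup_cons] at hl
    rcases List.mem_cons.1 h with h' | h'
    · simp only [Prod.mk.injEq] at h'
      obtain ⟨rfl, rfl⟩ := h'
      simp
    · have hne : a ≠ c₁ := by
        rintro rfl
        exact hl.1 (List.mem_map.2 ⟨(a, b), h', rfl⟩)
      rw [List.lookup_cons]
      have : (a == c₁) = false := by simpa using hne
      simpa [this] using ih hl.2 h'

/-- Shows that the two leftover lists zipped in `allPairs` have equal length, so that the zip
truncates neither. -/
theorem length_filter_notMem {m : ℕ} {l : List (Fin m)} (hl : l.Nodup) :
    ((List.finRange m).filter fun i => decide (i ∉ l)).length = m - l.length := by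
  rw [← List.toFinset_card_of_nodup ((List.nodup_finRange m).filter _)]
  have : ((List.finRange m).filter fun i => decide (i ∉ l)).toFinset = l.toFinsetᶜ := by
    ext i
    simp
  rw [this, Finset.card_compl, List.toFinset_card_of_nodup hl, Fintype.card_fin]

/-- A comparison of averages, with denominators cleared so that empty lists are allowed. -/
theorem length_mul_sum_le {a b : List ℝ} (h : ∀ x ∈ a, ∀ y ∈ b, y ≤ x) :
    (a.length : ℝ) * b.sum ≤ b.length * a.sum := by
  induction a with
  | nil => simp
  | cons x a ih =>
    have h1 := ih fun x hx => h x (List.mem_cons_of_mem _ hx)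
    have h2 : b.sum ≤ b.length * x := by
      have := List.sum_le_card_nsmul b x (h x List.mem_cons_self)
      simpa using this
    simp only [List.length_cons, List.sum_cons]
    push_cast
    nlinarith

/-- The sum of the smallest elements of a list is at most their share in its length. -/
theorem sum_drop_mul_length_le {l : List ℝ} (hl : l.Pairwise (· ≥ ·)) (k : ℕ) (hk : k ≤ l.length) :
    (l.drop k).sum * l.length ≤ (l.length - k) * l.sum := by
  have h1 : ∀ x ∈ l.take k, ∀ y ∈ l.drop k, y ≤ x := by
    rw [← List.take_append_drop k l, List.pairwise_append] at hl
    intro x hx y hy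
    exact hl.2.2 x hx y hy
  have h2 := length_mul_sum_le h1
  have h3 := List.sum_take_add_sum_drop l k
  rw [List.length_take, List.length_drop, min_eq_left hk, Nat.cast_sub hk] at h2
  rw [← h3]
  nlinarith

/-! ### The matching -/

variable {M d : ℕ} (h : M ≤ d) {m : ℕ}

theorem teacher_apply (j k : Fin M) :
    teacher h j (Fin.castLE h k) = if k = j then 1 else 0 := by
  simp [teacher]

theorem norm_teacher (j : Fin M) : ‖teacher h j‖ = 1 := by
  simp [teacher]

theorem norm_of_mem_ray {j : Fin M} {w : EuclideanSpace ℝ (Fin d)} (hw : w ∈ ray h j) :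
    ‖w‖ = w (Fin.castLE h j) := by
  obtain ⟨a, ha, rfl⟩ := hw
  simp [norm_smul, norm_teacher, teacher_apply, abs_of_pos ha]

theorem eq_smul_of_mem_ray {j : Fin M} {w : EuclideanSpace ℝ (Fin d)} (hw : w ∈ ray h j) :
    w = ‖w‖ • teacher h j := by
  obtain ⟨a, ha, rfl⟩ := hw
  simp [norm_smul, norm_teacher, abs_of_pos ha]

theorem ray_inj {j k : Fin M} {w : EuclideanSpace ℝ (Fin d)} (hj : w ∈ ray h j)
    (hk : w ∈ ray h k) : j = k := by
  obtain ⟨a, ha, rfl⟩ := hj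
  obtain ⟨b, hb, hab⟩ := hk
  by_contra hne
  have := congrArg (fun w : EuclideanSpace ℝ (Fin d) => w (Fin.castLE h j)) hab
  simp [teacher_apply, hne] at this
  exact ha.ne' this

theorem mem_typeRows {W : Weights m d} {j : Fin M} {i : Fin m} :
    i ∈ typeRows h W j ↔ W i ∈ ray h j := by
  simp [typeRows]

theorem sortedRows_perm (W : Weights m d) (j : Fin M) :
    (sortedRows h W j).Perm (typeRows h W j) :=
  List.mergeSort_perm _ _

theorem mem_sortedRows {W : Weights m d} {j : Fin M} {i : Fin m} :
    i ∈ sortedRows h W j ↔ W i ∈ ray h j := by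
  rw [(sortedRows_perm h W j).mem_iff, mem_typeRows]

theorem nodup_sortedRows (W : Weights m d) (j : Fin M) : (sortedRows h W j).Nodup :=
  (sortedRows_perm h W j).nodup_iff.2 ((List.nodup_finRange m).filter _)

theorem pairwise_map_sortedRows (W : Weights m d) (j : Fin M) :
    ((sortedRows h W j).map fun i => W i (Fin.castLE h j)).Pairwise (· ≥ ·) := by
  rw [List.pairwise_map]
  have := List.pairwise_mergeSort
    (le := fun a b : Fin m => decide (W b (Fin.castLE h j) ≤ W a (Fin.castLE h j)))
    (fun a b c hab hbc => by
      simp only [decide_eq_true_eq] at *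
      exact hbc.trans hab)
    (fun a b => by
      simp only [Bool.or_eq_true, decide_eq_true_eq]
      exact le_total _ _) (typeRows h W j)
  exact this.imp fun hab => by simpa using hab

theorem map_norm_sortedRows (W : Weights m d) (j : Fin M) :
    (sortedRows h W j).map (fun i => ‖W i‖) =
      (sortedRows h W j).map fun i => W i (Fin.castLE h j) :=
  List.map_congr_left fun _ hi => norm_of_mem_ray h ((mem_sortedRows h).1 hi)

/-- Distinct rays are disjoint, so lists of different types share no row. The free truncation `k`
covers both components of `matchedPairs`, where each list is cut at the length of the other, as well
as the full lists. -/
theorem nodup_flatMap_take (W : Weights m d) (k : Fin M → ℕ) :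
    ((List.finRange M).flatMap fun j => (sortedRows h W j).take (k j)).Nodup := by
  refine List.nodup_flatMap.2 ⟨fun j _ => (nodup_sortedRows h W j).take, ?_⟩
  refine (List.nodup_finRange M).imp fun {j l} hjl => ?_
  intro i hi hi'
  exact hjl (ray_inj h ((mem_sortedRows h).1 (List.mem_of_mem_take hi))
    ((mem_sortedRows h).1 (List.mem_of_mem_take hi')))

theorem map_fst_matchedPairs (W₁ W₂ : Weights m d) :
    (matchedPairs h W₁ W₂).map Prod.fst =
      (List.finRange M).flatMap fun j => (sortedRows h W₁ j).take (sortedRows h W₂ j).length := by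
  simp [matchedPairs, List.map_flatMap, map_fst_zip_eq_take]

theorem map_snd_matchedPairs (W₁ W₂ : Weights m d) :
    (matchedPairs h W₁ W₂).map Prod.snd =
      (List.finRange M).flatMap fun j => (sortedRows h W₂ j).take (sortedRows h W₁ j).length := by
  simp [matchedPairs, List.map_flatMap, map_snd_zip_eq_take]

theorem nodup_map_fst_matchedPairs (W₁ W₂ : Weights m d) :
    ((matchedPairs h W₁ W₂).map Prod.fst).Nodup := by
  rw [map_fst_matchedPairs]
  exact nodup_flatMap_take h W₁ _

theorem nodup_map_snd_matchedPairs (W₁ W₂ : Weights m d) :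
    ((matchedPairs h W₁ W₂).map Prod.snd).Nodup := by
  rw [map_snd_matchedPairs]
  exact nodup_flatMap_take h W₂ _

theorem map_fst_allPairs (W₁ W₂ : Weights m d) :
    (allPairs h W₁ W₂).map Prod.fst = (matchedPairs h W₁ W₂).map Prod.fst ++
      (List.finRange m).filter fun i => decide (i ∉ (matchedPairs h W₁ W₂).map Prod.fst) := by
  rw [allPairs, List.map_append, List.map_fst_zip]
  rw [length_filter_notMem (nodup_map_fst_matchedPairs h W₁ W₂),
    length_filter_notMem (nodup_map_snd_matchedPairs h W₁ W₂)]
  simp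

theorem map_snd_allPairs (W₁ W₂ : Weights m d) :
    (allPairs h W₁ W₂).map Prod.snd = (matchedPairs h W₁ W₂).map Prod.snd ++
      (List.finRange m).filter fun i => decide (i ∉ (matchedPairs h W₁ W₂).map Prod.snd) := by
  rw [allPairs, List.map_append, List.map_snd_zip]
  rw [length_filter_notMem (nodup_map_fst_matchedPairs h W₁ W₂),
    length_filter_notMem (nodup_map_snd_matchedPairs h W₁ W₂)]
  simp

theorem nodup_append_filter_notMem {l : List (Fin m)} (hl : l.Nodup) :
    (l ++ (List.finRange m).filter fun i => decide (i ∉ l)).Nodup := by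
  refine hl.append ((List.nodup_finRange m).filter _) fun i hi hi' => ?_
  simp at hi'
  exact hi' hi

/-- The row of `W₂` that the matching puts into the position `i`. -/
noncomputable def source (W₁ W₂ : Weights m d) (i : Fin m) : Fin m :=
  ((allPairs h W₁ W₂).lookup i).getD i

theorem permuted_apply (W₁ W₂ : Weights m d) (i : Fin m) :
    permuted h W₁ W₂ i = W₂ (source h W₁ W₂ i) := rfl

theorem source_eq_of_mem {W₁ W₂ : Weights m d} {i k : Fin m} (hik : (i, k) ∈ allPairs h W₁ W₂) :
    source h W₁ W₂ i = k := by
  have hn : ((allPairs h W₁ W₂).map Prod.fst).Nodup := by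
    rw [map_fst_allPairs]
    exact nodup_append_filter_notMem (nodup_map_fst_matchedPairs h W₁ W₂)
  rw [source, lookup_eq_some_of_mem hn hik, Option.getD_some]

theorem mem_allPairs_source (W₁ W₂ : Weights m d) (i : Fin m) :
    (i, source h W₁ W₂ i) ∈ allPairs h W₁ W₂ := by
  have : i ∈ (allPairs h W₁ W₂).map Prod.fst := by
    rw [map_fst_allPairs]
    by_cases hi : i ∈ (matchedPairs h W₁ W₂).map Prod.fst
    · exact List.mem_append_left _ hi
    · exact List.mem_append_right _ (by simpa using hi)
  obtain ⟨⟨a, b⟩, hab, rfl⟩ := List.mem_map.1 this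
  rwa [source_eq_of_mem h hab]

/-- By finiteness the matching is thus a permutation of the rows, so the permuted network computes
the same function as `W₂`. -/
theorem source_injective (W₁ W₂ : Weights m d) : Function.Injective (source h W₁ W₂) := by
  intro i k hik
  have hn : ((allPairs h W₁ W₂).map Prod.snd).Nodup := by
    rw [map_snd_allPairs]
    exact nodup_append_filter_notMem (nodup_map_snd_matchedPairs h W₁ W₂)
  have := List.inj_on_of_nodup_map hn (mem_allPairs_source h W₁ W₂ i)
    (mem_allPairs_source h W₁ W₂ k) hik
  exact congrArg Prod.fst this

theorem exists_ray_of_mem_matchedPairs {W₁ W₂ : Weights m d} {i : Fin m}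
    (hi : i ∈ (matchedPairs h W₁ W₂).map Prod.fst) :
    ∃ j, W₁ i ∈ ray h j ∧ W₂ (source h W₁ W₂ i) ∈ ray h j := by
  obtain ⟨⟨a, b⟩, hab, rfl⟩ := List.mem_map.1 hi
  rw [source_eq_of_mem h (List.mem_append_left _ hab)]
  obtain ⟨j, -, hj⟩ := List.mem_flatMap.1 hab
  have := List.of_mem_zip hj
  exact ⟨j, (mem_sortedRows h).1 this.1, (mem_sortedRows h).1 this.2⟩

theorem source_notMem_matchedPairs {W₁ W₂ : Weights m d} {i : Fin m}
    (hi : i ∉ (matchedPairs h W₁ W₂).map Prod.fst) :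
    source h W₁ W₂ i ∉ (matchedPairs h W₁ W₂).map Prod.snd := by
  rcases List.mem_append.1 (mem_allPairs_source h W₁ W₂ i) with h1 | h1
  · exact absurd (List.mem_map.2 ⟨_, h1, rfl⟩) hi
  · have := (List.of_mem_zip h1).2
    rw [List.mem_filter] at this
    simpa using this.2

/-! ### Sums over the rows -/

theorem sum_eq_sum_sortedRows {W : Weights m d} (hW : ∀ i, ∃ j, W i ∈ ray h j) (g : Fin m → ℝ) :
    ∑ i, g i = ∑ j, ((sortedRows h W j).map g).sum := by
  have hn : ((List.finRange M).flatMap fun j => sortedRows h W j).Nodup := by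
    have := nodup_flatMap_take h W fun j => (sortedRows h W j).length
    simpa using this
  have hu : ((List.finRange M).flatMap fun j => sortedRows h W j).toFinset = Finset.univ := by
    ext i
    simp [mem_sortedRows, hW i]
  rw [← hu, List.sum_toFinset _ hn, List.map_flatMap, List.flatMap, List.sum_flatten,
    List.map_map, ← List.ofFn_eq_map, List.sum_ofFn]
  rfl

/-- With every row on a ray, the sorted lists exhaust the rows, so what the heads leave out is
exactly the tails. Applied to norms, this is the mass of the unmatched rows. -/
theorem sum_compl_flatMap_take {W : Weights m d} (hW : ∀ i, ∃ j, W i ∈ ray h j) (g : Fin m → ℝ)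
    (k : Fin M → ℕ) :
    ∑ i with i ∉ ((List.finRange M).flatMap fun j => (sortedRows h W j).take (k j)), g i =
      ∑ j, (((sortedRows h W j).drop (k j)).map g).sum := by
  set l := (List.finRange M).flatMap fun j => (sortedRows h W j).take (k j) with hl
  have h1 : ∑ i with i ∈ l, g i = ∑ j, (((sortedRows h W j).take (k j)).map g).sum := by
    have : (Finset.univ.filter fun i => i ∈ l) = l.toFinset := by
      ext i
      simp
    rw [this, List.sum_toFinset _ (nodup_flatMap_take h W k), List.map_flatMap, List.flatMap,
      List.sum_flatten, List.map_map, ← List.ofFn_eq_map, List.sum_ofFn]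
    rfl
  have h2 := Finset.sum_filter_add_sum_filter_not Finset.univ (fun i => i ∈ l) g
  rw [h1, sum_eq_sum_sortedRows h hW] at h2
  have h3 : ∀ j, ((sortedRows h W j).map g).sum =
      (((sortedRows h W j).take (k j)).map g).sum +
        (((sortedRows h W j).drop (k j)).map g).sum := fun j => by
    rw [← List.sum_append, ← List.map_append, List.take_append_drop]
  simp only [h3, Finset.sum_add_distrib] at h2
  linarith

/-- A weight matrix that represents the teacher: all rows are on the rays, and for each `j` the
non-zero elements of the rows of type `j` sum up to one. -/
def IsSplitTeacher (W : Weights m d) : Prop :=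
  (∀ i, ∃ j, W i ∈ ray h j) ∧
    ∀ j, ((typeRows h W j).map fun i => W i (Fin.castLE h j)).sum = 1

variable {h}

theorem IsSplitTeacher.sum_sortedRows {W : Weights m d} (hW : IsSplitTeacher h W) (j : Fin M) :
    ((sortedRows h W j).map fun i => W i (Fin.castLE h j)).sum = 1 := by
  rw [← hW.2 j]
  exact ((sortedRows_perm h W j).map _).sum_eq

theorem relu_mul_of_nonneg {a : ℝ} (ha : 0 ≤ a) (z : ℝ) : relu (a * z) = a * relu z := by
  simp [relu, mul_max_of_nonneg _ _ ha]

theorem IsSplitTeacher.sum_relu {W : Weights m d} (hW : IsSplitTeacher h W)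
    (x : EuclideanSpace ℝ (Fin d)) :
    ∑ i, relu (inner ℝ (W i) x) = ∑ j, relu (inner ℝ (teacher h j) x) := by
  rw [sum_eq_sum_sortedRows h hW.1]
  refine Finset.sum_congr rfl fun j _ => ?_
  have : (sortedRows h W j).map (fun i => relu (inner ℝ (W i) x)) =
      (sortedRows h W j).map fun i =>
        W i (Fin.castLE h j) * relu (inner ℝ (teacher h j) x) := by
    refine List.map_congr_left fun i hi => ?_
    have hi := (mem_sortedRows h).1 hi
    rw [← norm_of_mem_ray h hi]
    conv_lhs => rw [eq_smul_of_mem_ray h hi]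
    rw [real_inner_smul_left, relu_mul_of_nonneg (norm_nonneg _)]
  rw [this, List.sum_map_mul_right, hW.sum_sortedRows, one_mul]

variable (h) in
/-- The number of neurons of type `j`. -/
noncomputable def typeCount (W : Weights m d) (j : Fin M) : ℕ := (typeRows h W j).length

theorem length_sortedRows (W : Weights m d) (j : Fin M) :
    (sortedRows h W j).length = typeCount h W j :=
  (sortedRows_perm h W j).length_eq

theorem IsSplitTeacher.sum_drop_le {W : Weights m d} (hW : IsSplitTeacher h W) (j : Fin M)
    (n : ℕ) {c : ℝ} (hc : 0 < c) :
    (((sortedRows h W j).drop n).map fun i => ‖W i‖).sum ≤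
      2 / c * (|typeCount h W j - c| + |n - c|) := by
  set l := (sortedRows h W j).map fun i => W i (Fin.castLE h j) with hl
  have hlen : l.length = typeCount h W j := by rw [hl, List.length_map, length_sortedRows]
  have heq : (((sortedRows h W j).drop n).map fun i => ‖W i‖) = l.drop n := by
    rw [List.map_drop, map_norm_sortedRows]
  rw [heq]
  have hsum : l.sum = 1 := hW.sum_sortedRows j
  have h0 : 0 ≤ 2 / c * (|typeCount h W j - c| + |n - c|) := by positivity
  rcases le_total l.length n with hn | hn
  · rwa [List.drop_eq_nil_of_le hn, List.sum_nil]
  have h1 := sum_drop_mul_length_le (pairwise_map_sortedRows h W j) n hn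
  rw [← hl, hsum, mul_one, hlen] at h1
  have hpos : 0 < typeCount h W j := by
    rw [← hlen]
    rcases Nat.eq_zero_or_pos l.length with h2 | h2
    · rw [List.length_eq_zero_iff] at h2
      simp [h2] at hsum
    · exact h2
  have hpos' : (0 : ℝ) < typeCount h W j := by exact_mod_cast hpos
  have hn' : (n : ℝ) ≤ typeCount h W j := by exact_mod_cast hlen ▸ hn
  have hn0 : (0 : ℝ) ≤ n := n.cast_nonneg
  set N : ℝ := (typeCount h W j : ℝ)
  have hA := le_abs_self (N - c)
  have hA' := neg_abs_le (N - c)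
  have hB := le_abs_self ((n : ℝ) - c)
  have hB' := neg_abs_le ((n : ℝ) - c)
  rw [div_mul_eq_mul_div, le_div_iff₀ hc]
  -- If `N ≥ c / 2`, the share `(N - n) / N` is at most `2 / c * (N - n)`. Otherwise `|N - c| ≥ c /
  -- 2`, so the right-hand side is at least one, while the tail sums to at most one.
  rcases le_total (c / 2) N with h2 | h2
  · by_cases hS : 0 ≤ (l.drop n).sum
    · nlinarith
    · nlinarith [abs_nonneg (N - c), abs_nonneg ((n : ℝ) - c)]
  · have : (l.drop n).sum ≤ 1 := by
      by_contra hcon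
      push Not at hcon
      nlinarith
    nlinarith [abs_nonneg (N - c), abs_nonneg ((n : ℝ) - c)]

/-! ### Output error along the interpolation -/

theorem abs_relu_add_sub_le (u v : ℝ) : |relu (u + v) - relu u - relu v| ≤ |u| + |v| := by
  unfold relu
  rcases le_total 0 u with hu | hu <;> rcases le_total 0 v with hv | hv <;>
    rcases le_total 0 (u + v) with huv | huv <;>
    simp only [max_eq_left, max_eq_right, abs_of_nonneg, abs_of_nonpos, hu, hv, huv] <;>
    rw [abs_le] <;> constructor <;> linarith

/-- The total deviation of the type counts of two weight matrices from `c`. -/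
noncomputable def countDeviation (h : M ≤ d) (c : ℝ) (W₁ W₂ : Weights m d) : ℝ :=
  ∑ j, (|typeCount h W₁ j - c| + |typeCount h W₂ j - c|)

/-- Both endpoints realize the teacher, so the error is the sum of the rowwise failures of ReLU to
be additive. These vanish on matched rows and are bounded by the norms on the others. Each type pays
`2 / c` times its deviations once for each matrix, whence the constant `4 / c`. -/
theorem abs_interpolation_sub_teacher_le {W₁ W₂ : Weights m d} (h₁ : IsSplitTeacher h W₁)
    (h₂ : IsSplitTeacher h W₂) {c : ℝ} (hc : 0 < c) {s : ℝ} (h0 : 0 ≤ s) (h1 : s ≤ 1)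
    {x : EuclideanSpace ℝ (Fin d)} (hx : ‖x‖ = 1) :
    |(∑ i, relu (inner ℝ ((s • W₁ + (1 - s) • permuted h W₁ W₂) i) x)) -
      ∑ j, relu (inner ℝ (teacher h j) x)| ≤ 4 / c * countDeviation h c W₁ W₂ := by
  have h1' : 0 ≤ 1 - s := sub_nonneg.2 h1
  set τ := source h W₁ W₂
  have hin : ∀ w : EuclideanSpace ℝ (Fin d), |inner ℝ w x| ≤ ‖w‖ := fun w => by
    simpa [hx] using abs_real_inner_le_norm w x
  have hτ : ∑ i, relu (inner ℝ (W₂ (τ i)) x) = ∑ j, relu (inner ℝ (teacher h j) x) := by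
    rw [← h₂.sum_relu]
    exact (Finite.injective_iff_bijective.1 (source_injective h W₁ W₂)).sum_comp
      fun i => relu (inner ℝ (W₂ i) x)
  set D : Fin m → ℝ := fun i => relu (inner ℝ ((s • W₁ + (1 - s) • permuted h W₁ W₂) i) x) -
    s * relu (inner ℝ (W₁ i) x) - (1 - s) * relu (inner ℝ (W₂ (τ i)) x) with hD
  have hDin : ∀ i, inner ℝ ((s • W₁ + (1 - s) • permuted h W₁ W₂) i) x =
      s * inner ℝ (W₁ i) x + (1 - s) * inner ℝ (W₂ (τ i)) x := fun i => by
    simp only [Pi.add_apply, Pi.smul_apply, inner_add_left, real_inner_smul_left, permuted_apply]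
    rfl
  have hsum : (∑ i, relu (inner ℝ ((s • W₁ + (1 - s) • permuted h W₁ W₂) i) x)) -
      ∑ j, relu (inner ℝ (teacher h j) x) = ∑ i, D i := by
    simp only [hD, Finset.sum_sub_distrib, ← Finset.mul_sum]
    rw [hτ, h₁.sum_relu]
    ring
  rw [hsum]
  set A := (matchedPairs h W₁ W₂).map Prod.fst with hA
  set B := (matchedPairs h W₁ W₂).map Prod.snd with hB
  have hDA : ∀ i ∈ A, D i = 0 := fun i hi => by
    obtain ⟨j, hj₁, hj₂⟩ := exists_ray_of_mem_matchedPairs h hi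
    obtain ⟨a, ha, ha'⟩ := hj₁
    obtain ⟨b, hb, hb'⟩ := hj₂
    simp only [hD, hDin]
    rw [ha', show W₂ (τ i) = b • teacher h j from hb', real_inner_smul_left, real_inner_smul_left,
      ← mul_assoc, ← mul_assoc, ← add_mul, relu_mul_of_nonneg (by positivity),
      relu_mul_of_nonneg ha.le, relu_mul_of_nonneg hb.le]
    ring
  have hDn : ∀ i, |D i| ≤ ‖W₁ i‖ + ‖W₂ (τ i)‖ := fun i => by
    have := abs_relu_add_sub_le (s * inner ℝ (W₁ i) x) ((1 - s) * inner ℝ (W₂ (τ i)) x)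
    rw [← hDin, relu_mul_of_nonneg h0, relu_mul_of_nonneg h1', abs_mul, abs_mul, abs_of_nonneg h0,
      abs_of_nonneg h1'] at this
    refine this.trans ?_
    have := hin (W₁ i)
    have := hin (W₂ (τ i))
    have := abs_nonneg (inner ℝ (W₁ i) x)
    have := abs_nonneg (inner ℝ (W₂ (τ i)) x)
    nlinarith
  -- Unmatched positions receive distinct unmatched rows of `W₂`.
  have hle : ∑ i with i ∉ A, ‖W₂ (τ i)‖ ≤ ∑ i with i ∉ B, ‖W₂ i‖ := by
    rw [← Finset.sum_image (f := fun i => ‖W₂ i‖) (g := τ)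
      fun _ _ _ _ hik => source_injective h W₁ W₂ hik]
    refine Finset.sum_le_sum_of_subset_of_nonneg ?_ fun _ _ _ => norm_nonneg _
    intro k hk
    obtain ⟨i, hi, rfl⟩ := Finset.mem_image.1 hk
    simp only [Finset.mem_filter, Finset.mem_univ, true_and] at hi ⊢
    exact source_notMem_matchedPairs h hi
  have hfA : ∑ i with i ∉ A, ‖W₁ i‖ =
      ∑ j, (((sortedRows h W₁ j).drop (typeCount h W₂ j)).map fun i => ‖W₁ i‖).sum := by
    rw [hA, map_fst_matchedPairs, sum_compl_flatMap_take h h₁.1]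
    simp only [length_sortedRows]
  have hfB : ∑ i with i ∉ B, ‖W₂ i‖ =
      ∑ j, (((sortedRows h W₂ j).drop (typeCount h W₁ j)).map fun i => ‖W₂ i‖).sum := by
    rw [hB, map_snd_matchedPairs, sum_compl_flatMap_take h h₂.1]
    simp only [length_sortedRows]
  calc |∑ i, D i| ≤ ∑ i, |D i| := Finset.abs_sum_le_sum_abs _ _
    _ = ∑ i with i ∉ A, |D i| := by
        rw [Finset.sum_filter]
        refine Finset.sum_congr rfl fun i _ => ?_
        split_ifs with hi
        · rw [hDA i hi, abs_zero]
        · rfl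
    _ ≤ ∑ i with i ∉ A, (‖W₁ i‖ + ‖W₂ (τ i)‖) := Finset.sum_le_sum fun i _ => hDn i
    _ ≤ ∑ i with i ∉ A, ‖W₁ i‖ + ∑ i with i ∉ B, ‖W₂ i‖ := by
        rw [Finset.sum_add_distrib]
        linarith
    _ ≤ ∑ j, (2 / c * (|typeCount h W₁ j - c| + |typeCount h W₂ j - c|) +
          2 / c * (|typeCount h W₂ j - c| + |typeCount h W₁ j - c|)) := by
        rw [hfA, hfB, ← Finset.sum_add_distrib]
        exact Finset.sum_le_sum fun j _ =>
          add_le_add (h₁.sum_drop_le j _ hc) (h₂.sum_drop_le j _ hc)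
    _ = 4 / c * countDeviation h c W₁ W₂ := by
        rw [countDeviation, Finset.mul_sum]
        refine Finset.sum_congr rfl fun j _ => ?_
        ring

/-! ### The barrier -/

instance : IsFiniteMeasure (sphereUniform d) := by
  unfold sphereUniform
  infer_instance

/-- The upper bound is all that the loss estimate needs, and it holds without knowing that the
surface measure is nonzero. -/
theorem sphereUniform_real_univ_le : (sphereUniform d).real Set.univ ≤ 1 := by
  refine ENNReal.toReal_le_of_le_ofReal zero_le_one ?_
  rw [sphereUniform, ProbabilityTheory.cond, Measure.smul_apply, Measure.restrict_univ, smul_eq_mul,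
    ENNReal.ofReal_one]
  exact ENNReal.inv_mul_le_one _

theorem loss_nonneg (W : Weights m d) : 0 ≤ loss h W :=
  integral_nonneg fun _ => sq_nonneg _

theorem loss_le_sq_of_abs_le {W : Weights m d} {K : ℝ}
    (hK : ∀ x : EuclideanSpace ℝ (Fin d), ‖x‖ = 1 →
      |(∑ i, relu (inner ℝ (W i) x)) - ∑ j, relu (inner ℝ (teacher h j) x)| ≤ K) :
    loss h W ≤ K ^ 2 := by
  refine (le_abs_self _).trans ?_
  have := norm_integral_le_of_norm_le_const (μ := sphereUniform d) (C := K ^ 2)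
    (f := fun x : Metric.sphere (0 : EuclideanSpace ℝ (Fin d)) 1 =>
      ((∑ i, relu (inner ℝ (W i) (x : EuclideanSpace ℝ (Fin d)))) -
      ∑ j, relu (inner ℝ (teacher h j) (x : EuclideanSpace ℝ (Fin d)))) ^ 2)
    (Eventually.of_forall fun x => by
      rw [norm_pow, Real.norm_eq_abs]
      exact pow_le_pow_left₀ (abs_nonneg _) (hK x (by simp)) 2)
  refine this.trans (mul_le_of_le_one_right (sq_nonneg _) sphereUniform_real_univ_le)

/-- The excess vanishes at the endpoint `s = 0`; boundedness makes the real supremum dominate it. -/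
theorem barrier_nonneg (W₁ W₂ : Weights m d) : 0 ≤ barrier h W₁ W₂ := by
  have := le_ciSup (bddAbove_excess h W₁ W₂) ⟨0, by simp⟩
  rw [barrier]
  simpa only [excess, zero_smul, sub_zero, one_smul, zero_add, zero_mul, one_mul, sub_self]
    using this

theorem IsSplitTeacher.barrier_le {W₁ W₂ : Weights m d} (h₁ : IsSplitTeacher h W₁)
    (h₂ : IsSplitTeacher h W₂) {c : ℝ} (hc : 0 < c) :
    barrier h W₁ (permuted h W₁ W₂) ≤ (4 / c * countDeviation h c W₁ W₂) ^ 2 := by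
  have : Nonempty (Set.Icc (0 : ℝ) 1) := ⟨⟨0, by simp⟩⟩
  refine ciSup_le fun ⟨s, h0, h1⟩ => ?_
  have hl : loss h (s • W₁ + (1 - s) • permuted h W₁ W₂) ≤ _ := loss_le_sq_of_abs_le fun x hx =>
    abs_interpolation_sub_teacher_le h₁ h₂ hc h0 h1 hx
  have := mul_nonneg h0 (loss_nonneg (h := h) W₁)
  have := mul_nonneg (sub_nonneg.2 h1) (loss_nonneg (h := h) (permuted h W₁ W₂))
  simp only [excess]
  linarith

/-! ### Measurability -/

variable (h)

theorem measurableSet_ray (j : Fin M) : MeasurableSet (ray h j) := by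
  -- The scalar of a point on the ray is its own coordinate, which removes the existential
  -- quantifier.
  have : ray h j = {w | 0 < w (Fin.castLE h j)} ∩
      {w | w = w (Fin.castLE h j) • teacher h j} := by
    ext w
    constructor
    · intro hw
      have := norm_of_mem_ray h hw
      refine ⟨?_, ?_⟩
      · obtain ⟨a, ha, rfl⟩ := hw
        simpa [teacher_apply] using ha
      · rw [Set.mem_ofPred_eq, ← this]
        exact eq_smul_of_mem_ray h hw
    · rintro ⟨h1, h2⟩
      exact ⟨_, h1, h2⟩
  rw [this]
  refine MeasurableSet.inter (measurableSet_lt (by fun_prop) (by fun_prop))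
    (measurableSet_eq_fun (by fun_prop) (by fun_prop))

/-- The finite information about a weight matrix that the matching algorithm uses: the types of the
rows and the order of the entries in each column. -/
abbrev MatchKey (M m : ℕ) : Type := (Fin M → Fin m → Bool) × (Fin M → Fin m → Fin m → Bool)

open Classical in
/-- The information about `W` that the matching algorithm uses. -/
noncomputable def matchKey (W : Weights m d) : MatchKey M m :=
  (fun j i => decide (W i ∈ ray h j),
    fun j a b => decide (W b (Fin.castLE h j) ≤ W a (Fin.castLE h j)))

theorem measurable_matchKey : Measurable (matchKey h : Weights m d → MatchKey M m) := by
  classical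
  refine Measurable.prodMk ?_ ?_
  · refine measurable_pi_lambda _ fun j => measurable_pi_lambda _ fun i => measurable_to_bool ?_
    have : MeasurableSet {W : Weights m d | W i ∈ ray h j} :=
      measurable_pi_apply i (measurableSet_ray h j)
    convert this using 1
    ext W
    simp
  · refine measurable_pi_lambda _ fun j => measurable_pi_lambda _ fun a =>
      measurable_pi_lambda _ fun b => measurable_to_bool ?_
    have : MeasurableSet {W : Weights m d | W b (Fin.castLE h j) ≤ W a (Fin.castLE h j)} :=
      measurableSet_le (by fun_prop) (by fun_prop)
    convert this using 1
    ext W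
    simp

/-- The type counts as a function of the `matchKey`. -/
theorem typeCount_eq (W : Weights m d) (j : Fin M) :
    typeCount h W j = ((List.finRange m).filter ((matchKey h W).1 j)).length := rfl

theorem measurable_typeCount :
    Measurable fun (W : Weights m d) => (fun j : Fin M => typeCount h W j) := by
  simp only [typeCount_eq]
  exact (measurable_of_finite fun K : MatchKey M m =>
    fun j => ((List.finRange m).filter (K.1 j)).length).comp (measurable_matchKey h)

/-- The matched pairs as a function of the keys. -/
def matchedPairsOfKeys (K₁ K₂ : MatchKey M m) : List (Fin m × Fin m) :=
  (List.finRange M).flatMap fun j =>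
    (((List.finRange m).filter (K₁.1 j)).mergeSort (K₁.2 j)).zip
      (((List.finRange m).filter (K₂.1 j)).mergeSort (K₂.2 j))

/-- The row that goes to position `i`, as a function of the keys. -/
def sourceOfKeys (K₁ K₂ : MatchKey M m) (i : Fin m) : Fin m :=
  (((matchedPairsOfKeys K₁ K₂ ++
    ((List.finRange m).filter fun i => decide (i ∉ (matchedPairsOfKeys K₁ K₂).map Prod.fst)).zip
      ((List.finRange m).filter fun i =>
        decide (i ∉ (matchedPairsOfKeys K₁ K₂).map Prod.snd))).lookup i).getD i)

theorem matchedPairs_eq (W₁ W₂ : Weights m d) :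
    matchedPairs h W₁ W₂ = matchedPairsOfKeys (matchKey h W₁) (matchKey h W₂) := by
  unfold matchedPairs matchedPairsOfKeys sortedRows typeRows matchKey
  congr!

theorem source_eq (W₁ W₂ : Weights m d) (i : Fin m) :
    source h W₁ W₂ i = sourceOfKeys (matchKey h W₁) (matchKey h W₂) i := by
  unfold source sourceOfKeys allPairs
  rw [matchedPairs_eq]

/-- The permutation depends on the weights only through finitely many possible keys, and for fixed
keys each row of the result is a coordinate projection. -/
theorem measurable_permuted :
    Measurable fun p : Weights m d × Weights m d => permuted h p.1 p.2 := by
  refine measurable_pi_lambda _ fun i => ?_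
  have h1 : Measurable fun q : Fin m × Weights m d => q.2 q.1 :=
    measurable_from_prod_countable_right fun k => measurable_pi_apply k
  have h2 : Measurable fun p : Weights m d × Weights m d =>
      (sourceOfKeys (matchKey h p.1) (matchKey h p.2) i, p.2) := by
    refine Measurable.prodMk ?_ measurable_snd
    exact (measurable_of_finite fun K : MatchKey M m × MatchKey M m =>
      sourceOfKeys K.1 K.2 i).comp
      (((measurable_matchKey h).comp measurable_fst).prodMk
        ((measurable_matchKey h).comp measurable_snd))
  convert h1.comp h2 using 2 with p
  simp [permuted_apply, source_eq]

theorem continuous_relu : Continuous relu := continuous_const.max continuous_id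

theorem continuous_loss : Continuous (loss h : Weights m d → ℝ) := by
  have := continuous_parametric_integral_of_continuous (μ := sphereUniform d)
    (f := fun (W : Weights m d) (x : Metric.sphere (0 : EuclideanSpace ℝ (Fin d)) 1) =>
      ((∑ i, relu (inner ℝ (W i) (x : EuclideanSpace ℝ (Fin d)))) -
        ∑ j, relu (inner ℝ (teacher h j) (x : EuclideanSpace ℝ (Fin d)))) ^ 2)
    (by
      have := continuous_relu
      simp only [Function.uncurry_def]
      fun_prop) (s := Set.univ) isCompact_univ
  simp only [Measure.restrict_univ] at this
  exact this

theorem continuous_barrier :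
    Continuous fun p : Weights m d × Weights m d => barrier h p.1 p.2 := by
  have h1 : Continuous ↿fun (p : Weights m d × Weights m d) (s : ℝ) => excess h p.1 p.2 s := by
    have := continuous_loss h (m := m)
    simp only [Function.HasUncurry.uncurry, excess, id]
    fun_prop
  have h2 := (isCompact_Icc (a := (0 : ℝ)) (b := 1)).continuous_sSup h1
  convert h2 using 2 with p
  rw [barrier, sSup_image', iSup]

theorem measurable_barrier_permuted :
    Measurable fun p : Weights m d × Weights m d => barrier h p.1 (permuted h p.1 p.2) := by
  have h1 := (continuous_barrier h (m := m)).measurable.comp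
    (measurable_fst.prodMk (measurable_permuted h))
  simpa only [Function.comp_def] using h1

/-! ### The type vector -/

variable {h}

theorem mem_typeEvent {Ω : Type*} {W : Ω → Weights m d} {α : Fin M → ℕ} {ω : Ω} :
    ω ∈ typeEvent h W α ↔ ∀ j, typeCount h (W ω) j = α j + 1 := Iff.rfl

theorem typeEvent_disjoint {Ω : Type*} {W : Ω → Weights m d} {α β : Fin M → ℕ} (hαβ : α ≠ β) :
    Disjoint (typeEvent h W α) (typeEvent h W β) := by
  refine Set.disjoint_left.2 fun ω hα hβ => hαβ (funext fun j => ?_)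
  have := (mem_typeEvent.1 hα j).symm.trans (mem_typeEvent.1 hβ j)
  omega

/-- The multinomial theorem as a generating function: `p = 1` yields the total mass, exponential `p`
the exponential moments. -/
theorem sum_multinomial_mul_prod (N : ℕ) (p : Fin M → ℝ) :
    ∑ α ∈ Finset.piAntidiag Finset.univ N,
      (Nat.multinomial Finset.univ α : ℝ) * (1 / (M : ℝ)) ^ N * ∏ j, p j ^ α j =
      (1 / (M : ℝ) * ∑ j, p j) ^ N := by
  rw [mul_pow, Finset.sum_pow_eq_sum_piAntidiag, Finset.mul_sum]
  refine Finset.sum_congr rfl fun α _ => ?_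
  ring

variable {Ω : Type*} [MeasurableSpace Ω] {P : Measure Ω} {W : Ω → Weights m d}

namespace IsUniformSolution

theorem nullMeasurableSet_typeEvent (hW : IsUniformSolution h P W) (α : Fin M → ℕ) :
    NullMeasurableSet (typeEvent h W α) P := by
  have h1 : MeasurableSet {V : Weights m d | (fun j => typeCount h V j) = fun j => α j + 1} :=
    measurable_typeCount h (measurableSet_singleton _)
  have h2 := hW.aemeasurable.nullMeasurableSet_preimage h1
  convert h2 using 1
  ext ω
  simp [mem_typeEvent, funext_iff]

theorem measure_typeEvent (hW : IsUniformSolution h P W) (hm : M ≤ m) {α : Fin M → ℕ}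
    (hα : α ∈ Finset.piAntidiag Finset.univ (m - M)) :
    P (typeEvent h W α) =
      ENNReal.ofReal ((Nat.multinomial Finset.univ α : ℝ) * (1 / (M : ℝ)) ^ (m - M)) := by
  refine hW.multinomial α ?_
  have : ∑ j, α j = m - M := (Finset.mem_piAntidiag.1 hα).1
  omega

/-- The type events are disjoint and their prescribed probabilities already add up to one. -/
theorem ae_exists_mem_typeEvent [IsProbabilityMeasure P] (hW : IsUniformSolution h P W)
    (hM : 1 ≤ M) (hm : M ≤ m) :
    ∀ᵐ ω ∂P, ∃ α ∈ Finset.piAntidiag Finset.univ (m - M), ω ∈ typeEvent h W α := by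
  have h1 : P (⋃ α ∈ Finset.piAntidiag Finset.univ (m - M), typeEvent h W α) = 1 := by
    rw [measure_biUnion_finset₀ (fun α _ β _ hαβ => (typeEvent_disjoint hαβ).aedisjoint)
      (fun α _ => hW.nullMeasurableSet_typeEvent α),
      Finset.sum_congr rfl fun α hα => hW.measure_typeEvent hm hα,
      ← ENNReal.ofReal_sum_of_nonneg fun α _ => by positivity]
    have := sum_multinomial_mul_prod (M := M) (m - M) fun _ => 1
    simp only [one_pow, Finset.prod_const_one, mul_one, Finset.sum_const, Finset.card_univ,
      Fintype.card_fin, nsmul_eq_mul] at this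
    have hM0 : (M : ℝ) ≠ 0 := by positivity
    rw [this, one_div, inv_mul_cancel₀ hM0, one_pow, ENNReal.ofReal_one]
  have h2 := (prob_compl_eq_zero_iff₀ (NullMeasurableSet.biUnion
    (Finset.countable_toSet (Finset.piAntidiag Finset.univ (m - M)))
    (fun α _ => hW.nullMeasurableSet_typeEvent α))).2 h1
  filter_upwards [compl_mem_ae_iff.2 h2] with ω hω
  simpa using hω

theorem lintegral_typeCount [IsProbabilityMeasure P] (hW : IsUniformSolution h P W)
    (hM : 1 ≤ M) (hm : M ≤ m) (F : (Fin M → ℕ) → ℝ≥0∞) :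
    ∫⁻ ω, F (typeCount h (W ω)) ∂P =
      ∑ α ∈ Finset.piAntidiag Finset.univ (m - M),
        ENNReal.ofReal ((Nat.multinomial Finset.univ α : ℝ) * (1 / (M : ℝ)) ^ (m - M)) *
          F fun j => α j + 1 := by
  have h1 : ∀ᵐ ω ∂P, F (typeCount h (W ω)) =
      ∑ α ∈ Finset.piAntidiag Finset.univ (m - M),
        (typeEvent h W α).indicator (fun _ => F fun j => α j + 1) ω := by
    filter_upwards [hW.ae_exists_mem_typeEvent hM hm] with ω ⟨α, hα, hω⟩
    rw [Finset.sum_eq_single_of_mem α hα fun β _ hβα =>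
      Set.indicator_of_notMem (fun hβ => Set.disjoint_left.1 (typeEvent_disjoint hβα) hβ hω) _,
      Set.indicator_of_mem hω]
    exact congrArg F (funext hω)
  rw [lintegral_congr_ae h1, lintegral_finsetSum' _ fun α _ =>
    aemeasurable_const.indicator₀ (hW.nullMeasurableSet_typeEvent α)]
  refine Finset.sum_congr rfl fun α hα => ?_
  rw [lintegral_indicator_const₀ (hW.nullMeasurableSet_typeEvent α), hW.measure_typeEvent hm hα,
    mul_comm]

end IsUniformSolution

/-! ### Exponential moments -/

theorem exp_le_one_add_add_sq {x : ℝ} (hx : |x| ≤ 1) : Real.exp x ≤ 1 + x + x ^ 2 := by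
  have := (abs_le.1 (Real.abs_exp_sub_one_sub_id_le hx)).2
  linarith

/-- The exponential moment of one centred draw: in `exp x ≤ 1 + x + x ^ 2` the linear terms average
to zero. -/
theorem average_exp_le (hM : 1 ≤ M) (j : Fin M) {t : ℝ} (ht : |t| ≤ 1) :
    1 / (M : ℝ) * ∑ i, Real.exp (t * ((if i = j then 1 else 0) - 1 / M)) ≤ 1 + t ^ 2 := by
  have hM1 : (1 : ℝ) ≤ M := by exact_mod_cast hM
  have hM0 : (0 : ℝ) < M := by linarith
  set y : Fin M → ℝ := fun i => (if i = j then 1 else 0) - 1 / (M : ℝ) with hy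
  have hinv : 1 / (M : ℝ) ≤ 1 := (div_le_one hM0).2 hM1
  have hinv0 : 0 < 1 / (M : ℝ) := by positivity
  have hyb : ∀ i, |y i| ≤ 1 := fun i => by
    simp only [hy]
    split_ifs <;> rw [abs_le] <;> constructor <;> linarith
  have h1 : ∀ i, Real.exp (t * y i) ≤ 1 + t * y i + t ^ 2 := fun i => by
    have h2 : |t * y i| ≤ 1 := by
      rw [abs_mul]
      exact mul_le_one₀ ht (abs_nonneg _) (hyb i)
    have h3 : y i ^ 2 ≤ 1 := (sq_le_one_iff_abs_le_one _).2 (hyb i)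
    have := exp_le_one_add_add_sq h2
    nlinarith [sq_nonneg t]
  have hsum : ∑ i, y i = 0 := by
    simp [hy, hM0.ne']
  calc 1 / (M : ℝ) * ∑ i, Real.exp (t * y i)
      ≤ 1 / (M : ℝ) * ∑ i, (1 + t * y i + t ^ 2) := by gcongr with i; exact h1 i
    _ = 1 + t ^ 2 := by
      rw [Finset.sum_add_distrib, Finset.sum_add_distrib, ← Finset.mul_sum, hsum]
      simp only [Finset.sum_const, Finset.card_univ, Fintype.card_fin, nsmul_eq_mul]
      field_simp
      ring

namespace IsUniformSolution

theorem lintegral_exp_typeCount [IsProbabilityMeasure P] (hW : IsUniformSolution h P W)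
    (hM : 1 ≤ M) (hm : M ≤ m) (j : Fin M) {t : ℝ} (ht : |t| ≤ 1) :
    ∫⁻ ω, ENNReal.ofReal (Real.exp (t * (typeCount h (W ω) j - m / M))) ∂P ≤
      ENNReal.ofReal (Real.exp (m * t ^ 2)) := by
  have hM0 : (M : ℝ) ≠ 0 := by positivity
  rw [hW.lintegral_typeCount hM hm fun n => ENNReal.ofReal (Real.exp (t * (n j - m / M)))]
  rw [Finset.sum_congr rfl fun α _ => (ENNReal.ofReal_mul (by positivity)).symm,
    ← ENNReal.ofReal_sum_of_nonneg fun α _ => by positivity]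
  refine ENNReal.ofReal_le_ofReal ?_
  -- Because `α` sums to `m - M`, the guaranteed extra row of type `j` cancels `M / M`: the number
  -- `α j + 1 - m / M` is exactly the sum of the `m - M` centred draws.
  have h1 : ∀ α ∈ Finset.piAntidiag (Finset.univ : Finset (Fin M)) (m - M),
      Real.exp (t * (((α j + 1 : ℕ) : ℝ) - m / M)) =
        ∏ i, Real.exp (t * ((if i = j then 1 else 0) - 1 / M)) ^ α i := by
    intro α hα
    have h2 : (∑ i, (α i : ℝ)) = m - M := by
      rw [← Nat.cast_sub hm, ← (Finset.mem_piAntidiag.1 hα).1]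
      simp
    simp only [← Real.exp_nat_mul]
    rw [← Real.exp_sum]
    congr 1
    have h3 : ∀ i, (α i : ℝ) * (t * ((if i = j then 1 else 0) - 1 / M)) =
        t * (if i = j then (α i : ℝ) else 0) - t / M * α i := fun i => by
      split_ifs <;> ring
    simp only [h3, Finset.sum_sub_distrib, ← Finset.mul_sum, h2, Finset.sum_ite_eq',
      Finset.mem_univ, if_true]
    push_cast
    field_simp
    ring
  rw [Finset.sum_congr rfl fun α hα => by rw [h1 α hα], sum_multinomial_mul_prod]
  calc _ ≤ (1 + t ^ 2) ^ (m - M) := by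
        refine pow_le_pow_left₀ (by positivity) (average_exp_le hM j ht) _
    _ ≤ (1 + t ^ 2) ^ m := pow_le_pow_right₀ (by nlinarith [sq_nonneg t]) (Nat.sub_le _ _)
    _ ≤ Real.exp (t ^ 2) ^ m := by
        refine pow_le_pow_left₀ (by positivity) ?_ _
        have := Real.add_one_le_exp (t ^ 2)
        linarith
    _ = Real.exp (m * t ^ 2) := by rw [← Real.exp_nat_mul]

/-- The moments of the type counts, centred and scaled by `√m`, are bounded uniformly in `m`. -/
theorem lintegral_abs_typeCount_pow_le [IsProbabilityMeasure P] (hW : IsUniformSolution h P W)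
    (hM : 1 ≤ M) (hm : M ≤ m) (j : Fin M) (k : ℕ) :
    ∫⁻ ω, ENNReal.ofReal ((|(typeCount h (W ω) j : ℝ) - m / M| / √m) ^ k) ∂P ≤
      ENNReal.ofReal (k.factorial * (2 * Real.exp 1)) := by
  have hm1 : (1 : ℝ) ≤ m := by exact_mod_cast hM.trans hm
  have hs1 : 1 ≤ √(m : ℝ) := Real.one_le_sqrt.2 hm1
  have hs0 : 0 < √(m : ℝ) := by linarith
  -- This scale makes `m * t ^ 2 = 1`, so both exponential moments are at most `exp 1`; then `x ^ k
  -- ≤ k! * exp x` and `exp |x| ≤ exp x + exp (-x)` give the moments.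
  set t : ℝ := 1 / √m with ht
  have ht1 : |t| ≤ 1 := by
    rw [abs_of_pos (by positivity)]
    exact (div_le_one hs0).2 hs1
  have hmt : (m : ℝ) * t ^ 2 = 1 := by
    rw [ht, div_pow, Real.sq_sqrt (by positivity)]
    field_simp
  have h1 := hW.lintegral_exp_typeCount hM hm j ht1
  have h2 := hW.lintegral_exp_typeCount hM hm j (t := -t) (by rwa [abs_neg])
  rw [neg_sq, hmt] at h2
  rw [hmt] at h1
  have hpt : ∀ ω, ENNReal.ofReal ((|(typeCount h (W ω) j : ℝ) - m / M| / √m) ^ k) ≤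
      ENNReal.ofReal k.factorial *
        (ENNReal.ofReal (Real.exp (t * (typeCount h (W ω) j - m / M))) +
          ENNReal.ofReal (Real.exp (-t * (typeCount h (W ω) j - m / M)))) := fun ω => by
    rw [← ENNReal.ofReal_add (by positivity) (by positivity), ← ENNReal.ofReal_mul (by positivity)]
    refine ENNReal.ofReal_le_ofReal ?_
    set z : ℝ := (typeCount h (W ω) j : ℝ) - m / M
    have h3 := Real.pow_div_factorial_le_exp (|z| / √m) (by positivity) k
    have h4 : |z| / √m = |t * z| := by
      rw [abs_mul, abs_of_pos (show 0 < t by positivity), ht]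
      ring
    have h5 := Real.exp_abs_le (t * z)
    rw [div_le_iff₀ (by positivity), mul_comm] at h3
    refine h3.trans ?_
    rw [h4, neg_mul]
    gcongr
  have hmeas : AEMeasurable
      (fun ω => ENNReal.ofReal (Real.exp (t * (typeCount h (W ω) j - m / M)))) P := by
    have h3 : Measurable fun n : Fin M → ℕ =>
      ENNReal.ofReal (Real.exp (t * ((n j : ℝ) - m / M))) := measurable_of_countable _
    exact (h3.comp (measurable_typeCount h)).comp_aemeasurable hW.aemeasurable
  calc _ ≤ _ := lintegral_mono hpt
    _ ≤ ENNReal.ofReal k.factorial *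
        (ENNReal.ofReal (Real.exp 1) + ENNReal.ofReal (Real.exp 1)) := by
        rw [lintegral_const_mul' _ _ ENNReal.ofReal_ne_top, lintegral_add_left' hmeas]
        gcongr
    _ = _ := by
        rw [← ENNReal.ofReal_add (by positivity) (by positivity),
          ← ENNReal.ofReal_mul (by positivity)]
        ring_nf

/-! ### The entries -/

/-- The simplex law enters only through its support: on each type event the entries of a type almost
surely sum to one, and finitely many such events cover almost every outcome. -/
theorem ae_isSplitTeacher [IsProbabilityMeasure P] (hW : IsUniformSolution h P W)
    (hM : 1 ≤ M) (hm : M ≤ m) : ∀ᵐ ω ∂P, IsSplitTeacher h (W ω) := by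
  have h1 : ∀ α ∈ Finset.piAntidiag (Finset.univ : Finset (Fin M)) (m - M), ∀ j,
      ∀ᵐ ω ∂P, ω ∈ typeEvent h W α → ∑ k, typeEntries h (W ω) j (α j + 1) k = 1 := by
    intro α hα j
    have hM0 : (0 : ℝ) < M := by exact_mod_cast hM
    have hpos : P (typeEvent h W α) ≠ 0 := by
      rw [hW.measure_typeEvent hm hα]
      have := Nat.multinomial_pos (s := (Finset.univ : Finset (Fin M))) (f := α)
      have : (0 : ℝ) < Nat.multinomial Finset.univ α := by exact_mod_cast this
      exact (ENNReal.ofReal_pos.2 (by positivity)).ne'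
    have hlaw := hW.simplex α (by have : ∑ j, α j = m - M := (Finset.mem_piAntidiag.1 hα).1; omega) j
    have hms : MeasurableSet {x : EuclideanSpace ℝ (Fin (α j + 1)) |
        (∀ k, 0 ≤ x k) ∧ ∑ k, x k = 1} := by
      have h2 : MeasurableSet {x : EuclideanSpace ℝ (Fin (α j + 1)) | ∀ k, 0 ≤ x k} := by
        rw [Set.ofPred_forall]
        exact MeasurableSet.iInter fun k => measurableSet_le (by fun_prop) (by fun_prop)
      exact h2.inter (measurableSet_eq_fun (by fun_prop) (by fun_prop))
    have h2 : ∀ᵐ x ∂simplexUniform (α j), (∀ k, 0 ≤ x k) ∧ ∑ k, x k = 1 :=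
      ae_cond_mem hms
    rw [← hlaw.map_eq] at h2
    have h3 := ae_of_ae_map hlaw.aemeasurable h2
    rw [ProbabilityTheory.cond, Measure.ae_ennreal_smul_measure_iff
      (ENNReal.inv_ne_zero.2 (measure_ne_top _ _)),
      ae_restrict_iff'₀ (hW.nullMeasurableSet_typeEvent α)] at h3
    filter_upwards [h3] with ω hω hmem
    exact (hω hmem).2
  have h2 : ∀ᵐ ω ∂P, ∀ α ∈ Finset.piAntidiag (Finset.univ : Finset (Fin M)) (m - M), ∀ j,
      ω ∈ typeEvent h W α → ∑ k, typeEntries h (W ω) j (α j + 1) k = 1 :=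
    (Finset.eventually_all _).2 fun α hα => ae_all_iff.2 (h1 α hα)
  filter_upwards [hW.no_zero, hW.ae_exists_mem_typeEvent hM hm, h2] with ω hω ⟨α, hα, hmem⟩ hsum
  refine ⟨hω, fun j => ?_⟩
  rw [← hsum α hα j hmem]
  have hlen := hmem j
  set l := (typeRows h (W ω) j).map fun i => W ω i (Fin.castLE h j) with hl
  have hlen' : l.length = α j + 1 := by rw [hl, List.length_map, hlen]
  -- On the type event the list has exactly `α j + 1` elements, so the default zero is never read.
  have : ∀ k, typeEntries h (W ω) j (α j + 1) k = l.getD k 0 := fun k => rfl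
  simp only [this]
  rw [← hlen', ← List.sum_ofFn]
  congr 1
  refine List.ext_getElem (by simp) fun k h1 h2 => ?_
  simp

end IsUniformSolution

/-! ### Bounds of the barrier -/

/-- The deviation of the number of neurons of type `j` from `m / M`, in units of `√m`. -/
noncomputable def scaledDeviation (h : M ≤ d) (W : Weights m d) (j : Fin M) : ℝ :=
  |(typeCount h W j : ℝ) - m / M| / √m

/-- Take `c = m / M`. The prefactor squares to `16 * M ^ 2 / m ^ 2`; Cauchy–Schwarz over the types
costs `M`, the square of a sum of two costs `2`, and the scaling by `√m` returns a factor `m`. -/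
theorem IsSplitTeacher.barrier_le_scaledDeviation {W₁ W₂ : Weights m d}
    (h₁ : IsSplitTeacher h W₁) (h₂ : IsSplitTeacher h W₂) (hM : 1 ≤ M) (hm : M ≤ m) :
    barrier h W₁ (permuted h W₁ W₂) ≤
      32 * M ^ 3 / m * ∑ j, (scaledDeviation h W₁ j ^ 2 + scaledDeviation h W₂ j ^ 2) := by
  have hM0 : (0 : ℝ) < M := by exact_mod_cast hM
  have hm0 : (0 : ℝ) < m := by exact_mod_cast hM.trans hm
  refine (h₁.barrier_le h₂ (div_pos hm0 hM0)).trans ?_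
  have hsq : √(m : ℝ) ^ 2 = m := Real.sq_sqrt hm0.le
  have h3 : countDeviation h (m / M) W₁ W₂ ^ 2 ≤
      M * ∑ j, 2 * m * (scaledDeviation h W₁ j ^ 2 + scaledDeviation h W₂ j ^ 2) := by
    have := sq_sum_le_card_mul_sum_sq (s := (Finset.univ : Finset (Fin M)))
      (f := fun j => |(typeCount h W₁ j : ℝ) - m / M| + |(typeCount h W₂ j : ℝ) - m / M|)
    rw [Finset.card_univ, Fintype.card_fin] at this
    refine this.trans (mul_le_mul_of_nonneg_left (Finset.sum_le_sum fun j _ => ?_) hM0.le)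
    simp only [scaledDeviation, div_pow, hsq]
    rw [← add_div, mul_assoc, mul_div_cancel₀ _ hm0.ne']
    nlinarith [sq_nonneg (|(typeCount h W₁ j : ℝ) - m / M| - |(typeCount h W₂ j : ℝ) - m / M|)]
  rw [← Finset.mul_sum] at h3
  rw [mul_pow]
  refine (mul_le_mul_of_nonneg_left h3 (by positivity)).trans (le_of_eq ?_)
  field_simp
  ring

theorem aemeasurable_scaledDeviation {W : Ω → Weights m d} (hW : AEMeasurable W P) (j : Fin M) :
    AEMeasurable (fun ω => scaledDeviation h (W ω) j) P := by
  have h3 : Measurable fun n : Fin M → ℕ => |(n j : ℝ) - m / M| / √m := measurable_of_countable _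
  exact (h3.comp (measurable_typeCount h)).comp_aemeasurable hW

theorem aemeasurable_barrier {W₁ W₂ : Ω → Weights m d} (h₁ : AEMeasurable W₁ P)
    (h₂ : AEMeasurable W₂ P) :
    AEMeasurable (fun ω => barrier h (W₁ ω) (permuted h (W₁ ω) (W₂ ω))) P := by
  have := (measurable_barrier_permuted h).comp_aemeasurable (h₁.prodMk h₂)
  simpa only [Function.comp_def] using this

theorem lintegral_barrier_le [IsProbabilityMeasure P] {W₁ W₂ : Ω → Weights m d}
    (h₁ : IsUniformSolution h P W₁) (h₂ : IsUniformSolution h P W₂) (hM : 1 ≤ M) (hm : M ≤ m) :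
    ∫⁻ ω, ENNReal.ofReal (barrier h (W₁ ω) (permuted h (W₁ ω) (W₂ ω))) ∂P ≤
      ENNReal.ofReal (256 * Real.exp 1 * M ^ 4 / m) := by
  have hc : (0 : ℝ) ≤ 32 * M ^ 3 / m := by positivity
  have hpt : ∀ᵐ ω ∂P, ENNReal.ofReal (barrier h (W₁ ω) (permuted h (W₁ ω) (W₂ ω))) ≤
      ENNReal.ofReal (32 * M ^ 3 / m) * ∑ j, (ENNReal.ofReal (scaledDeviation h (W₁ ω) j ^ 2) +
        ENNReal.ofReal (scaledDeviation h (W₂ ω) j ^ 2)) := by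
    filter_upwards [h₁.ae_isSplitTeacher hM hm, h₂.ae_isSplitTeacher hM hm] with ω hω₁ hω₂
    refine (ENNReal.ofReal_le_ofReal (hω₁.barrier_le_scaledDeviation hω₂ hM hm)).trans ?_
    rw [ENNReal.ofReal_mul hc, ENNReal.ofReal_sum_of_nonneg fun j _ => by positivity]
    simp only [ENNReal.ofReal_add (sq_nonneg _) (sq_nonneg _), le_refl]
  have hme₁ : ∀ j, AEMeasurable (fun ω => ENNReal.ofReal (scaledDeviation h (W₁ ω) j ^ 2)) P :=
    fun j => ((aemeasurable_scaledDeviation h₁.aemeasurable j).pow_const 2).ennreal_ofReal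
  have hme₂ : ∀ j, AEMeasurable (fun ω => ENNReal.ofReal (scaledDeviation h (W₂ ω) j ^ 2)) P :=
    fun j => ((aemeasurable_scaledDeviation h₂.aemeasurable j).pow_const 2).ennreal_ofReal
  refine (lintegral_mono_ae hpt).trans ?_
  rw [lintegral_const_mul' _ _ ENNReal.ofReal_ne_top,
    lintegral_finsetSum' _ fun j _ => (hme₁ j).fun_add (hme₂ j)]
  -- Each second moment is at most `2! * 2 * exp 1`, and there are two matrices.
  have hj : ∀ j ∈ (Finset.univ : Finset (Fin M)),
      ∫⁻ ω, (ENNReal.ofReal (scaledDeviation h (W₁ ω) j ^ 2) +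
        ENNReal.ofReal (scaledDeviation h (W₂ ω) j ^ 2)) ∂P ≤
      ENNReal.ofReal (8 * Real.exp 1) := fun j _ => by
    rw [lintegral_add_left' (hme₁ j)]
    refine (add_le_add (h₁.lintegral_abs_typeCount_pow_le hM hm j 2)
      (h₂.lintegral_abs_typeCount_pow_le hM hm j 2)).trans (le_of_eq ?_)
    rw [← ENNReal.ofReal_add (by positivity) (by positivity)]
    congr 1
    norm_num [Nat.factorial]
    ring
  refine (mul_le_mul_right (Finset.sum_le_card_nsmul _ _ _ hj) _).trans (le_of_eq ?_)
  rw [Finset.card_univ, Fintype.card_fin, ← ENNReal.ofReal_nsmul, ← ENNReal.ofReal_mul hc,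
    nsmul_eq_mul]
  congr 1
  ring

theorem rpow_neg_half (m : ℕ) : (m : ℝ) ^ (-(1 / 2) : ℝ) = 1 / √m := by
  rw [Real.rpow_neg m.cast_nonneg, ← Real.sqrt_eq_rpow, one_div]

theorem integrable_barrier_and_integral_le [IsProbabilityMeasure P] {W₁ W₂ : Ω → Weights m d}
    (h₁ : IsUniformSolution h P W₁) (h₂ : IsUniformSolution h P W₂) (hM : 1 ≤ M) (hm : M ≤ m) :
    Integrable (fun ω => barrier h (W₁ ω) (permuted h (W₁ ω) (W₂ ω))) P ∧
      ∫ ω, barrier h (W₁ ω) (permuted h (W₁ ω) (W₂ ω)) ∂P ≤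
        256 * Real.exp 1 * M ^ 4 / m := by
  have hmeas := (aemeasurable_barrier (h := h) h₁.aemeasurable
    h₂.aemeasurable).aestronglyMeasurable
  have hnn : 0 ≤ᵐ[P] fun ω => barrier h (W₁ ω) (permuted h (W₁ ω) (W₂ ω)) :=
    Eventually.of_forall fun ω => barrier_nonneg _ _
  have hle := lintegral_barrier_le h₁ h₂ hM hm
  refine ⟨(lintegral_ofReal_ne_top_iff_integrable hmeas hnn).1
    (ne_top_of_le_ne_top ENNReal.ofReal_ne_top hle), ?_⟩
  rw [integral_eq_lintegral_of_nonneg_ae hnn hmeas]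
  exact ENNReal.toReal_le_of_le_ofReal (by positivity) hle

/-! ### Almost sure bounds -/

/-- Markov's inequality for the sixth moment bounds the exceptional probability by a multiple of `m
^ (-3/2)`, which is summable; the fourth moment would give only `1 / m`. This half of Borel–Cantelli
needs no independence between widths. -/
theorem ae_eventually_scaledDeviation_sq_le [IsProbabilityMeasure P]
    {W : (m : ℕ) → Ω → Weights m d} (hW : ∀ m, M ≤ m → IsUniformSolution h P (W m))
    (hM : 1 ≤ M) (j : Fin M) :
    ∀ᵐ ω ∂P, ∀ᶠ m : ℕ in atTop, scaledDeviation h (W m ω) j ^ 2 ≤ √m := by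
  -- The clause `M ≤ m` empties the event at the widths about which nothing is assumed.
  set s : ℕ → Set Ω := fun m => {ω | M ≤ m ∧ √(m : ℝ) ^ 3 ≤ scaledDeviation h (W m ω) j ^ 6}
  set K : ℝ := (6).factorial * (2 * Real.exp 1)
  have hs : ∀ m, P (s m) ≤ ENNReal.ofReal (K * (1 / √(m : ℝ) ^ 3)) := fun m => by
    by_cases hm : M ≤ m
    · have hm0 : (0 : ℝ) < m := by exact_mod_cast hM.trans hm
      have hpos : 0 < √(m : ℝ) ^ 3 := by positivity
      have hme := ((aemeasurable_scaledDeviation (h := h) (hW m hm).aemeasurable j).pow_const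
        6).ennreal_ofReal
      have h1 := meas_ge_le_lintegral_div hme (ε := ENNReal.ofReal (√(m : ℝ) ^ 3))
        (ENNReal.ofReal_pos.2 hpos).ne' ENNReal.ofReal_ne_top
      refine (measure_mono ?_).trans (h1.trans ?_)
      · intro ω hω
        exact ENNReal.ofReal_le_ofReal hω.2
      · rw [mul_one_div, ENNReal.ofReal_div_of_pos hpos]
        gcongr
        exact (hW m hm).lintegral_abs_typeCount_pow_le hM hm j 6
    · have : s m = ∅ := Set.eq_empty_of_forall_notMem fun ω hω => hm hω.1
      simp [this]
  have hsum : Summable fun m : ℕ => K * (1 / √(m : ℝ) ^ 3) := by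
    refine Summable.mul_left K ?_
    have := Real.summable_one_div_nat_rpow.2 (show (1 : ℝ) < 3 / 2 by norm_num)
    refine this.congr fun m => ?_
    rw [Real.sqrt_eq_rpow, ← Real.rpow_natCast, ← Real.rpow_mul m.cast_nonneg]
    norm_num
  have hne : ∑' m, P (s m) ≠ ∞ :=
    ne_top_of_le_ne_top hsum.tsum_ofReal_ne_top (ENNReal.tsum_le_tsum hs)
  filter_upwards [ae_eventually_notMem hne] with ω hω
  filter_upwards [hω, eventually_ge_atTop M] with m hm hMm
  by_contra hcon
  push Not at hcon
  refine hm ⟨hMm, ?_⟩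
  calc √(m : ℝ) ^ 3 ≤ (scaledDeviation h (W m ω) j ^ 2) ^ 3 :=
        pow_le_pow_left₀ (Real.sqrt_nonneg _) hcon.le 3
    _ = scaledDeviation h (W m ω) j ^ 6 := by ring

theorem ae_eventually_barrier_le [IsProbabilityMeasure P] {W₁ W₂ : (m : ℕ) → Ω → Weights m d}
    (h₁ : ∀ m, M ≤ m → IsUniformSolution h P (W₁ m))
    (h₂ : ∀ m, M ≤ m → IsUniformSolution h P (W₂ m)) (hM : 1 ≤ M) :
    ∀ᵐ ω ∂P, ∀ᶠ m : ℕ in atTop,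
      barrier h (W₁ m ω) (permuted h (W₁ m ω) (W₂ m ω)) ≤
        64 * M ^ 4 * (m : ℝ) ^ (-(1 / 2) : ℝ) := by
  have hs₁ : ∀ᵐ ω ∂P, ∀ m, M ≤ m → IsSplitTeacher h (W₁ m ω) :=
    ae_all_iff.2 fun m => eventually_imp_distrib_left.2 fun hm => (h₁ m hm).ae_isSplitTeacher hM hm
  have hs₂ : ∀ᵐ ω ∂P, ∀ m, M ≤ m → IsSplitTeacher h (W₂ m ω) :=
    ae_all_iff.2 fun m => eventually_imp_distrib_left.2 fun hm => (h₂ m hm).ae_isSplitTeacher hM hm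
  filter_upwards [hs₁, hs₂, ae_all_iff.2 (ae_eventually_scaledDeviation_sq_le h₁ hM),
    ae_all_iff.2 (ae_eventually_scaledDeviation_sq_le h₂ hM)] with ω hω₁ hω₂ hd₁ hd₂
  filter_upwards [eventually_all.2 hd₁, eventually_all.2 hd₂, eventually_ge_atTop M] with m hm₁ hm₂
    hm
  have hm0 : (0 : ℝ) < m := by exact_mod_cast hM.trans hm
  have hsq : √(m : ℝ) ^ 2 = m := Real.sq_sqrt hm0.le
  refine ((hω₁ m hm).barrier_le_scaledDeviation (hω₂ m hm) hM hm).trans ?_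
  calc _ ≤ 32 * M ^ 3 / m * ∑ _j : Fin M, (√(m : ℝ) + √m) :=
        mul_le_mul_of_nonneg_left (Finset.sum_le_sum fun j _ => add_le_add (hm₁ j) (hm₂ j))
          (by positivity)
    _ = 64 * M ^ 4 * (m : ℝ) ^ (-(1 / 2) : ℝ) := by
        rw [rpow_neg_half, Finset.sum_const, Finset.card_univ, Fintype.card_fin, nsmul_eq_mul]
        have : √(m : ℝ) ≠ 0 := by positivity
        field_simp
        rw [hsq]
        ring

theorem tendsto_mul_rpow_neg_half (C : ℝ) :
    Tendsto (fun m : ℕ => C * (m : ℝ) ^ (-(1 / 2) : ℝ)) atTop (𝓝 0) := by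
  have := ((tendsto_rpow_neg_atTop (show (0 : ℝ) < 1 / 2 by norm_num)).comp
    tendsto_natCast_atTop_atTop).const_mul C
  simpa using this

end LMC

theorem theorem6 (M d : ℕ) (hM : 1 ≤ M) (hMd : M ≤ d) :
    ∃ C : ℝ, ∀ (Ω : Type*) [MeasurableSpace Ω] (P : Measure Ω) [IsProbabilityMeasure P]
      (W₁ W₂ : (m : ℕ) → Ω → LMC.Weights m d),
      (∀ m, M ≤ m → LMC.IsUniformSolution hMd P (W₁ m)) →
      (∀ m, M ≤ m → LMC.IsUniformSolution hMd P (W₂ m)) →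
      -- in expectation
      ((∀ m, M ≤ m →
          Integrable (fun ω => LMC.barrier hMd (W₁ m ω)
            (LMC.permuted hMd (W₁ m ω) (W₂ m ω))) P ∧
          ∫ ω, LMC.barrier hMd (W₁ m ω) (LMC.permuted hMd (W₁ m ω) (W₂ m ω)) ∂P
            ≤ C * (m : ℝ) ^ (-(1 / 2) : ℝ)) ∧
        Tendsto (fun m : ℕ =>
          ∫ ω, LMC.barrier hMd (W₁ m ω) (LMC.permuted hMd (W₁ m ω) (W₂ m ω)) ∂P)
          atTop (𝓝 0)) ∧
      -- almost surely
      (∀ᵐ ω ∂P,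
        Tendsto (fun m : ℕ =>
          LMC.barrier hMd (W₁ m ω) (LMC.permuted hMd (W₁ m ω) (W₂ m ω))) atTop (𝓝 0) ∧
        ∀ᶠ m : ℕ in atTop,
          |LMC.barrier hMd (W₁ m ω) (LMC.permuted hMd (W₁ m ω) (W₂ m ω))|
            ≤ C * (m : ℝ) ^ (-(1 / 2) : ℝ)) := by
  -- The constant of the expectation bound; it also exceeds the almost sure constant `64 * M ^ 4`.
  refine ⟨256 * Real.exp 1 * M ^ 4, fun Ω _ P _ W₁ W₂ h₁ h₂ => ?_⟩
  have hE : ∀ m, M ≤ m →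
      Integrable (fun ω => LMC.barrier hMd (W₁ m ω)
        (LMC.permuted hMd (W₁ m ω) (W₂ m ω))) P ∧
      ∫ ω, LMC.barrier hMd (W₁ m ω) (LMC.permuted hMd (W₁ m ω) (W₂ m ω)) ∂P
        ≤ 256 * Real.exp 1 * M ^ 4 * (m : ℝ) ^ (-(1 / 2) : ℝ) := fun m hm => by
    obtain ⟨hi, hle⟩ := LMC.integrable_barrier_and_integral_le (h₁ m hm) (h₂ m hm) hM hm
    have hm1 : (1 : ℝ) ≤ m := by exact_mod_cast hM.trans hm
    refine ⟨hi, hle.trans ?_⟩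
    rw [LMC.rpow_neg_half, mul_one_div]
    gcongr
    -- Here the rate `1 / m` is weakened to `1 / √m`, using `m ≥ 1`.
    exact Real.sqrt_le_iff.2 ⟨by positivity, by nlinarith⟩
  refine ⟨⟨hE, ?_⟩, ?_⟩
  · refine squeeze_zero' (Eventually.of_forall fun m => integral_nonneg fun ω =>
      LMC.barrier_nonneg _ _) ?_ (LMC.tendsto_mul_rpow_neg_half (256 * Real.exp 1 * M ^ 4))
    filter_upwards [eventually_ge_atTop M] with m hm using (hE m hm).2
  · filter_upwards [LMC.ae_eventually_barrier_le h₁ h₂ hM] with ω hω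
    have hω' : ∀ᶠ m : ℕ in atTop,
        LMC.barrier hMd (W₁ m ω) (LMC.permuted hMd (W₁ m ω) (W₂ m ω)) ≤
          256 * Real.exp 1 * M ^ 4 * (m : ℝ) ^ (-(1 / 2) : ℝ) := by
      filter_upwards [hω] with m hm
      refine hm.trans ?_
      gcongr
      linarith [Real.one_le_exp (zero_le_one (α := ℝ))]
    refine ⟨squeeze_zero' (Eventually.of_forall fun m => LMC.barrier_nonneg _ _) hω'
      (LMC.tendsto_mul_rpow_neg_half _), ?_⟩
    filter_upwards [hω'] with m hm
    rwa [abs_of_nonneg (LMC.barrier_nonneg _ _)]
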